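/- For $n\ge 3$ let $B_{n,2}$ be the $(n,2)$-bubble-sort graph: its vertices are the ordered pairs $(a_1,a_2)$ of distinct elements of $\{1,\dots,n\}$, and two distinct vertices $(a_1,a_2)$ and $(b_1,b_2)$ are adjacent if and only if either $(b_1,b_2)=(a_2,a_1)$, or $a_2=b_2$ and $a_1\ne b_1$. For a graph $G$ and a set $S\subseteq V(G)$, let $\kappa_G(S)$ be the maximum number $r$ of pairwise edge-disjoint trees $T_1,\dots,T_r$ in $G$, each containing all vertices of $S$, such that $V(T_i)\cap V(T_j)=S$ for all $i\neq j$; and let $\kappa_3(G)=\min\{\kappa_G(S): S\subseteq V(G),\ |S|=3\}$ be the generalized $3$-connectivity of $G$. Then for every $n\ge 3$, $$\kappa_3(B_{n,2})=n-2.$$ -/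

import Mathlib

/-- The `(n, k)`-bubble-sort graph. Its vertices are the arrangements `a₁ a₂ ⋯ a_k` of `k` distinct
elements of an `n`-element set (positions and symbols are counted from `0` here). Two arrangements
are adjacent when one arises from the other by swapping the entries at two consecutive positions,
or when they differ exactly in the first entry. -/
def bubbleSortGraph (n k : ℕ) : SimpleGraph (Fin k ↪ Fin n) where
  Adj u v :=
    (∃ i j : Fin k, (i : ℕ) + 1 = j ∧ u i = v j ∧ u j = v i ∧
      ∀ l : Fin k, l ≠ i → l ≠ j → u l = v l) ∨
    (∃ i : Fin k, (i : ℕ) = 0 ∧ u i ≠ v i ∧ ∀ l : Fin k, l ≠ i → u l = v l)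
  symm := ⟨by
    rintro u v (⟨i, j, hij, h1, h2, h3⟩ | ⟨i, hi, h1, h2⟩)
    · exact Or.inl ⟨i, j, hij, h2.symm, h1.symm, fun l hl hl' => (h3 l hl hl').symm⟩
    · exact Or.inr ⟨i, hi, h1.symm, fun l hl => (h2 l hl).symm⟩⟩
  loopless := ⟨by
    rintro u (⟨i, j, hij, h1, -, -⟩ | ⟨i, -, h1, -⟩)
    · have h := u.injective h1
      subst h
      omega
    · exact h1 rfl⟩

namespace SimpleGraph

variable {V : Type*}

/-- `T 0, …, T (r - 1)` are internally disjoint trees of `G` connecting `S`: each is a subtree of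
`G` containing `S`, and any two of them are edge-disjoint and meet exactly in the vertices
of `S`. -/
structure IsInternallyDisjointTrees (G : SimpleGraph V) (S : Finset V) {r : ℕ}
    (T : Fin r → G.Subgraph) : Prop where
  isTree : ∀ i, (T i).coe.IsTree
  subset_verts : ∀ i, (S : Set V) ⊆ (T i).verts
  inter_verts : ∀ i j, i ≠ j → (T i).verts ∩ (T j).verts = (S : Set V)
  disjoint_edges : ∀ i j, i ≠ j → Disjoint (T i).edgeSet (T j).edgeSet

/-- `κ_G(S)`: the maximum number of internally disjoint trees of `G` connecting `S`
(`⊤` if there are arbitrarily many). -/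
noncomputable def treeConnectivity (G : SimpleGraph V) (S : Finset V) : ℕ∞ :=
  sSup {m : ℕ∞ | ∃ (r : ℕ) (T : Fin r → G.Subgraph),
    G.IsInternallyDisjointTrees S T ∧ m = (r : ℕ∞)}

/-- The generalized `k`-connectivity `κ_k(G)`: the minimum of `κ_G(S)` over all `k`-element sets `S`
of vertices (`⊤` if there is no such set). -/
noncomputable def generalizedConnectivity (k : ℕ) (G : SimpleGraph V) : ℕ∞ :=
  sInf {m : ℕ∞ | ∃ S : Finset V, S.card = k ∧ m = G.treeConnectivity S}

end SimpleGraph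

/-! Write `ab` for an arrangement. Upper bound: take `S = {ab, ba, cb}`. At one of `ab`, `ba`, every
tree has an edge other than the swap edge (`exists_neighbor_ne`); only `n - 2` such edges exist
there. Lower bound: fix two symbols `p`, `q` depending on `S`. Each other symbol `i` gets a
connected subgraph whose inner vertices are mostly arrangements containing `i`; spanning trees of
these are internally disjoint. The cases are the coincidences among the last symbols of `S`. -/

namespace SimpleGraph

/-! ### Disjoint trees in a general graph -/

variable {V : Type*} {G : SimpleGraph V}

theorem Subgraph.connected_of_forall_closed {H : G.Subgraph} {x : V} (hx : x ∈ H.verts)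
    (h : ∀ P : V → Prop, P x → (∀ u v, H.Adj u v → P u → P v) → ∀ v ∈ H.verts, P v) :
    H.coe.Connected := by
  have key := h (fun v => ∃ hv : v ∈ H.verts, H.coe.Reachable ⟨x, hx⟩ ⟨v, hv⟩) ⟨hx, .refl _⟩ (by
    rintro u v huv ⟨hu, hr⟩
    refine ⟨huv.snd_mem, hr.trans (Adj.reachable ?_)⟩
    exact huv)
  have : Nonempty H.verts := ⟨⟨x, hx⟩⟩
  refine ⟨fun u v => ?_⟩
  obtain ⟨_, hu⟩ := key u u.2
  obtain ⟨_, hv⟩ := key v v.2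
  exact hu.symm.trans hv

theorem Subgraph.exists_isTree_of_connected {H : G.Subgraph} (hH : H.coe.Connected) :
    ∃ T : G.Subgraph, T ≤ H ∧ T.verts = H.verts ∧ T.coe.IsTree := by
  obtain ⟨T, hT, hT'⟩ := hH.exists_isTree_le
  refine ⟨{ verts := H.verts
            Adj := fun u v => ∃ (hu : u ∈ H.verts) (hv : v ∈ H.verts), T.Adj ⟨u, hu⟩ ⟨v, hv⟩
            adj_sub := ?_
            edge_vert := fun ⟨hu, _⟩ => hu
            symm := ⟨fun u v ⟨hu, hv, h⟩ => ⟨hv, hu, h.symm⟩⟩ }, ⟨le_rfl, ?_⟩, rfl, ?_⟩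
  · rintro u v ⟨hu, hv, h⟩
    exact H.adj_sub (hT h)
  · rintro u v ⟨hu, hv, h⟩
    exact hT h
  · convert hT'
    ext u v
    simp

/-- Disjoint inner sets suffice: edges within `S` are the only ones two subgraphs could share, and
they are reserved for the index `i₀`. -/
theorem exists_isInternallyDisjointTrees {ι : Type*} {S : Finset V} {x : V} (hx : x ∈ S)
    {m : ℕ} (e : Fin m → ι) (he : Function.Injective e) (A : ι → V → Prop) (i₀ : ι)
    (hA : ∀ i j, e i ≠ e j → ∀ v, A (e i) v → A (e j) v → v ∈ S)
    (hconn : ∀ i, ∀ P : V → Prop, P x →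
      (∀ u v, (A (e i) u ∨ u ∈ S) → (A (e i) v ∨ v ∈ S) → G.Adj u v →
        (u ∈ S → v ∈ S → e i = i₀) → P u → P v) →
      ∀ v, (A (e i) v ∨ v ∈ S) → P v) :
    ∃ T : Fin m → G.Subgraph, G.IsInternallyDisjointTrees S T := by
  let H : Fin m → G.Subgraph := fun i =>
    { verts := {v | A (e i) v ∨ v ∈ S}
      Adj := fun u v => (A (e i) u ∨ u ∈ S) ∧ (A (e i) v ∨ v ∈ S) ∧ G.Adj u v ∧
        (u ∈ S → v ∈ S → e i = i₀)
      adj_sub := fun h => h.2.2.1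
      edge_vert := fun h => h.1
      symm := ⟨fun u v h => ⟨h.2.1, h.1, h.2.2.1.symm, fun hv hu => h.2.2.2 hu hv⟩⟩ }
  have hH : ∀ i, (H i).coe.Connected := fun i =>
    Subgraph.connected_of_forall_closed (x := x) (Or.inr hx) fun P hP hs =>
      hconn i P hP fun u v hu hv huv hS => hs u v ⟨hu, hv, huv, hS⟩
  have hverts : ∀ i j, i ≠ j → (H i).verts ∩ (H j).verts = (S : Set V) := by
    intro i j hij
    ext v
    constructor
    · rintro ⟨h | h, h' | h'⟩
      · exact hA i j (he.ne hij) v h h'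
      all_goals assumption
    · exact fun h => ⟨Or.inr h, Or.inr h⟩
  choose T hT hTv hTt using fun i => Subgraph.exists_isTree_of_connected (hH i)
  refine ⟨T, hTt, fun i v hv => ?_, fun i j hij => ?_, fun i j hij => ?_⟩
  · rw [hTv]
    exact Or.inr hv
  · rw [hTv, hTv, hverts i j hij]
  · rw [Set.disjoint_left]
    intro p
    induction p using Sym2.ind with
    | _ u v =>
      intro hi hj
      have hi' : (H i).Adj u v := (hT i).2 hi
      have hj' : (H j).Adj u v := (hT j).2 hj
      have hu : u ∈ S := by
        have : u ∈ (H i).verts ∩ (H j).verts := ⟨hi'.fst_mem, hj'.fst_mem⟩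
        rwa [hverts i j hij] at this
      have hv : v ∈ S := by
        have : v ∈ (H i).verts ∩ (H j).verts := ⟨hi'.snd_mem, hj'.snd_mem⟩
        rwa [hverts i j hij] at this
      exact hij (he ((hi'.2.2.2 hu hv).trans (hj'.2.2.2 hu hv).symm))

/-- If `u v w` are in `S`, then internally disjoint trees connecting `S` all leave one of the
endpoints `u`, `v` along edges other than `uv`. -/
theorem IsInternallyDisjointTrees.exists_neighbor_ne {S : Finset V} {r : ℕ}
    {T : Fin r → G.Subgraph} (hT : G.IsInternallyDisjointTrees S T) {u v w : V} (hu : u ∈ S)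
    (hv : v ∈ S) (hw : w ∈ S) (huv : u ≠ v) (huw : u ≠ w) (hvw : v ≠ w) :
    (∀ i, ∃ x, x ≠ v ∧ (T i).Adj u x) ∨ (∀ i, ∃ x, x ≠ u ∧ (T i).Adj v x) := by
  have leave : ∀ i, ∀ P : V → Prop, (∀ a b, (T i).Adj a b → P a → P b) →
      ∀ a ∈ S, P a → ∀ b ∈ S, P b := by
    intro i P hP a ha hPa b hb
    obtain ⟨p⟩ := (hT.isTree i).connected.preconnected ⟨a, hT.subset_verts i ha⟩
      ⟨b, hT.subset_verts i hb⟩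
    have : ∀ (c d : (T i).verts), (T i).coe.Walk c d → P c → P d := by
      intro c d p
      induction p with
      | nil => exact id
      | cons h _ ih => exact fun hc => ih (hP _ _ h hc)
    exact this _ _ p hPa
  -- Otherwise `u` is a leaf at `v` in one tree and `v` a leaf at `u` in another. Both contain the
  -- edge `uv`, so they coincide, and `{u, v}` is cut off from `w`.
  by_contra! h
  obtain ⟨⟨i, hi⟩, ⟨j, hj⟩⟩ := h
  have hi' : (T i).Adj u v := by
    by_contra hn
    refine huv.symm (leave i (· = u) ?_ u hu rfl v hv)
    rintro a b hab rfl
    by_cases hb : b = v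
    · exact absurd (hb ▸ hab) hn
    · exact absurd hab (hi b hb)
  have hj' : (T j).Adj v u := by
    by_contra hn
    refine huv (leave j (· = v) ?_ v hv rfl u hu)
    rintro a b hab rfl
    by_cases hb : b = u
    · exact absurd (hb ▸ hab) hn
    · exact absurd hab (hj b hb)
  have hij : i = j := by
    by_contra hne
    exact Set.disjoint_left.1 (hT.disjoint_edges i j hne)
      (show s(u, v) ∈ (T i).edgeSet from hi') hj'.symm
  subst hij
  have := leave i (fun a => a = u ∨ a = v) ?_ u hu (Or.inl rfl) w hw
  · grind
  · rintro a b hab (rfl | rfl)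
    · by_cases hb : b = v
      · exact Or.inr hb
      · exact absurd hab (hi b hb)
    · by_cases hb : b = u
      · exact Or.inl hb
      · exact absurd hab (hj b hb)

end SimpleGraph

open SimpleGraph

/-! ### Arrangements as pairs of symbols -/

theorem embedding_fin_two_ext {n : ℕ} {u v : Fin 2 ↪ Fin n} (h0 : u 0 = v 0) (h1 : u 1 = v 1) :
    u = v := by
  ext i
  fin_cases i
  · exact congrArg Fin.val h0
  · exact congrArg Fin.val h1

theorem embedding_fin_two_ne {n : ℕ} (u : Fin 2 ↪ Fin n) : u 0 ≠ u 1 :=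
  u.injective.ne (by decide)

/-- The arrangement `a b`. -/
def arrangement {n : ℕ} (a b : Fin n) (h : a ≠ b) : Fin 2 ↪ Fin n :=
  ⟨![a, b], by
    intro i j hij
    fin_cases i <;> fin_cases j <;> simp_all [h.symm]⟩

@[simp] theorem arrangement_zero {n : ℕ} (a b : Fin n) (h : a ≠ b) : arrangement a b h 0 = a := rfl

@[simp] theorem arrangement_one {n : ℕ} (a b : Fin n) (h : a ≠ b) : arrangement a b h 1 = b := rfl

theorem bubbleSortGraph_two_adj {n : ℕ} {u v : Fin 2 ↪ Fin n} :
    (bubbleSortGraph n 2).Adj u v ↔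
      (u 0 = v 1 ∧ u 1 = v 0) ∨ (u 0 ≠ v 0 ∧ u 1 = v 1) := by
  simp [bubbleSortGraph, Fin.exists_fin_two, Fin.forall_fin_two]

theorem card_compl_pair {n : ℕ} {p q : Fin n} (hpq : p ≠ q) :
    ({p, q}ᶜ : Finset (Fin n)).card = n - 2 := by
  rw [Finset.card_compl, Fintype.card_fin, Finset.card_pair hpq]

/-- Pairs of symbols `(a, b)` stand for arrangements `a b`; `R` describes the set `S`, and `A i`
the inner vertices of the tree with index `i`, where `i` ranges over the symbols other than `p`
and `q`. -/
theorem bubbleSortGraph_exists_trees {n : ℕ} {S : Finset (Fin 2 ↪ Fin n)}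
    {R : Fin n → Fin n → Prop} (hR : ∀ v, v ∈ S ↔ R (v 0) (v 1)) {x : Fin 2 ↪ Fin n} (hx : x ∈ S)
    {p q : Fin n} (hpq : p ≠ q) (A : Fin n → Fin n → Fin n → Prop) (i₀ : Fin n)
    (hA : ∀ i j, i ≠ p → i ≠ q → j ≠ p → j ≠ q → i ≠ j → ∀ a b, a ≠ b → A i a b → A j a b → R a b)
    (hconn : ∀ i, i ≠ p → i ≠ q → ∀ Q : Fin n → Fin n → Prop, Q (x 0) (x 1) →
      (∀ a b, a ≠ b → (A i a b ∨ R a b) → (A i b a ∨ R b a) → (R a b → R b a → i = i₀) →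
        Q a b → Q b a) →
      (∀ a a' b, a ≠ b → a' ≠ b → (A i a b ∨ R a b) → (A i a' b ∨ R a' b) →
        (R a b → R a' b → i = i₀) → Q a b → Q a' b) →
      ∀ a b, a ≠ b → (A i a b ∨ R a b) → Q a b) :
    ∃ T : Fin (n - 2) → (bubbleSortGraph n 2).Subgraph,
      (bubbleSortGraph n 2).IsInternallyDisjointTrees S T := by
  have hc := card_compl_pair hpq
  let e : Fin (n - 2) → Fin n := ({p, q}ᶜ : Finset (Fin n)).orderEmbOfFin hc
  have he : ∀ i, e i ≠ p ∧ e i ≠ q := by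
    intro i
    have := Finset.orderEmbOfFin_mem ({p, q}ᶜ : Finset (Fin n)) hc i
    rwa [Finset.mem_compl, Finset.mem_insert, Finset.mem_singleton, not_or] at this
  refine exists_isInternallyDisjointTrees hx e (Finset.orderEmbOfFin _ hc).injective
    (fun i v => A i (v 0) (v 1)) i₀ ?_ ?_
  · intro i j hij v hi hj
    exact (hR v).2 (hA _ _ (he i).1 (he i).2 (he j).1 (he j).2 hij _ _
      (embedding_fin_two_ne v) hi hj)
  · intro i P hP hs v hv
    -- The predicate is vacuously true on the diagonal, where no arrangement exists.
    have key := hconn (e i) (he i).1 (he i).2 (fun a b => ∀ h : a ≠ b, P (arrangement a b h))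
      (fun h => by
        have : arrangement (x 0) (x 1) h = x := embedding_fin_two_ext rfl rfl
        rwa [this]) ?_ ?_ (v 0) (v 1) (embedding_fin_two_ne v)
        (by rw [← hR]; exact hv) (embedding_fin_two_ne v)
    · have : arrangement (v 0) (v 1) (embedding_fin_two_ne v) = v := embedding_fin_two_ext rfl rfl
      rwa [this] at key
    · intro a b hab h1 h2 h3 hQ hba
      refine hs (arrangement a b hab) (arrangement b a hba) ?_ ?_ ?_ ?_ (hQ hab)
      · simpa [hR] using h1
      · simpa [hR] using h2
      · simp [bubbleSortGraph_two_adj]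
      · simpa [hR] using h3
    · intro a a' b hab hab' h1 h2 h3 hQ _
      by_cases haa : a = a'
      · subst haa
        exact hQ hab
      refine hs (arrangement a b hab) (arrangement a' b hab') ?_ ?_ ?_ ?_ (hQ hab)
      · simpa [hR] using h1
      · simpa [hR] using h2
      · simp [bubbleSortGraph_two_adj, haa]
      · simpa [hR] using h3

/-! ### Lower bound: trees for each triple -/

theorem mem_triple_iff {n : ℕ} (x y z v : Fin 2 ↪ Fin n) :
    v ∈ ({x, y, z} : Finset (Fin 2 ↪ Fin n)) ↔
      (v 0 = x 0 ∧ v 1 = x 1) ∨ (v 0 = y 0 ∧ v 1 = y 1) ∨ (v 0 = z 0 ∧ v 1 = z 1) := by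
  have h : ∀ u w : Fin 2 ↪ Fin n, u = w ↔ u 0 = w 0 ∧ u 1 = w 1 := fun u w =>
    ⟨by rintro rfl; exact ⟨rfl, rfl⟩, fun h => embedding_fin_two_ext h.1 h.2⟩
  simp [h]

/-- With common last symbol `b`, a generic `i` gives a star centred at `ib`. For `i = y 0` and `i =
z 0` that centre lies in `S`: the former uses the triangle on `S`, the latter a detour. -/
theorem bubbleSortGraph_exists_trees_of_same_last {n : ℕ} {x y z : Fin 2 ↪ Fin n}
    (hxy : x 0 ≠ y 0) (hxz : x 0 ≠ z 0) (hyz : y 0 ≠ z 0) (h1 : x 1 = y 1) (h2 : x 1 = z 1) :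
    ∃ T : Fin (n - 2) → (bubbleSortGraph n 2).Subgraph,
      (bubbleSortGraph n 2).IsInternallyDisjointTrees {x, y, z} T := by
  have hx := embedding_fin_two_ne x
  have hy := embedding_fin_two_ne y
  have hz := embedding_fin_two_ne z
  refine bubbleSortGraph_exists_trees
    (R := fun a b => (a = x 0 ∧ b = x 1) ∨ (a = y 0 ∧ b = y 1) ∨ (a = z 0 ∧ b = z 1))
    (mem_triple_iff x y z) (x := x) (by simp) hx
    (fun i a b => i ≠ y 0 ∧ ((i ≠ z 0 ∧ a = i ∧ b = x 1) ∨ (i = z 0 ∧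
      ((a = x 1 ∧ (b = x 0 ∨ b = y 0 ∨ b = z 0)) ∨ (a = x 0 ∧ (b = y 0 ∨ b = z 0)) ∨
        (b = x 0 ∧ (a = y 0 ∨ a = z 0))))))
    (y 0) ?_ ?_
  · grind
  · rw [← h1, ← h2] at *
    generalize x 0 = x0 at *
    generalize y 0 = y0 at *
    generalize z 0 = z0 at *
    generalize x 1 = b at *
    intro i hi hi' Q hQ hswap hmove
    by_cases hiy : i = y0
    · grind
    by_cases hiz : i = z0
    · have q1 : Q b x0 := by grind
      have q2 : Q y0 x0 := by grind
      have q3 : Q z0 x0 := by grind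
      have q4 : Q x0 y0 := by grind
      have q5 : Q x0 z0 := by grind
      have q6 : Q b y0 := by grind
      have q7 : Q b z0 := by grind
      have q8 : Q y0 b := by grind
      have q9 : Q z0 b := by grind
      grind
    · have q1 : Q i b := by grind
      have q8 : Q y0 b := by grind
      have q9 : Q z0 b := by grind
      grind

/-- With last symbols `b, b, c`, the path `ib, bi, ci, ic` joins the neighbours of `x`, `y` to those
of `z`. For `i = c` it shrinks to `cb, bc`; for `i = y 0` it starts at `y` itself, so the edge `xy`
is needed. -/
theorem bubbleSortGraph_exists_trees_of_two_same_last {n : ℕ} {x y z : Fin 2 ↪ Fin n}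
    (h1 : x 1 = y 1) (h2 : x 1 ≠ z 1) (h3 : y 0 ≠ z 1) :
    ∃ T : Fin (n - 2) → (bubbleSortGraph n 2).Subgraph,
      (bubbleSortGraph n 2).IsInternallyDisjointTrees {x, y, z} T := by
  have hx := embedding_fin_two_ne x
  have hy := embedding_fin_two_ne y
  have hz := embedding_fin_two_ne z
  refine bubbleSortGraph_exists_trees
    (R := fun a b => (a = x 0 ∧ b = x 1) ∨ (a = y 0 ∧ b = y 1) ∨ (a = z 0 ∧ b = z 1))
    (mem_triple_iff x y z) (x := x) (by simp) hx
    (fun i a b => (a = i ∧ (b = x 1 ∨ b = z 1)) ∨ (b = i ∧ (a = x 1 ∨ a = z 1)))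
    (y 0) ?_ ?_
  · grind
  · rw [← h1] at *
    generalize x 0 = x0 at *
    generalize y 0 = y0 at *
    generalize z 0 = z0 at *
    generalize x 1 = b at *
    generalize z 1 = c at *
    intro i hi hi' Q hQ hswap hmove
    have q1 : Q i b := by grind
    have q2 : Q y0 b := by grind
    have q3 : Q b i := by grind
    by_cases hc : i = c
    · have q4 : Q z0 c := by grind
      grind
    · have q4 : Q c i := by grind
      have q5 : Q i c := by grind
      have q6 : Q z0 c := by grind
      grind

/-- With last symbols `b, c, d`, the triangle `bi, ci, di` has pendants `ib, ic, id` leading to `x,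
y, z`. For `i = d` the pairs `dd` are missing, and `z` is itself adjacent or equal to `bd` and `cd`.
-/
theorem bubbleSortGraph_exists_trees_of_distinct_last {n : ℕ} {x y z : Fin 2 ↪ Fin n}
    (h1 : x 1 ≠ y 1) (h2 : x 1 ≠ z 1) (h3 : y 1 ≠ z 1) :
    ∃ T : Fin (n - 2) → (bubbleSortGraph n 2).Subgraph,
      (bubbleSortGraph n 2).IsInternallyDisjointTrees {x, y, z} T := by
  have hx := embedding_fin_two_ne x
  have hy := embedding_fin_two_ne y
  have hz := embedding_fin_two_ne z
  refine bubbleSortGraph_exists_trees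
    (R := fun a b => (a = x 0 ∧ b = x 1) ∨ (a = y 0 ∧ b = y 1) ∨ (a = z 0 ∧ b = z 1))
    (mem_triple_iff x y z) (x := x) (by simp) h1
    (fun i a b => (a = i ∧ (b = x 1 ∨ b = y 1 ∨ b = z 1)) ∨
      (b = i ∧ (a = x 1 ∨ a = y 1 ∨ a = z 1)) ∨
      (i = z 1 ∧ ((a = x 1 ∧ b = y 1) ∨ (a = y 1 ∧ b = x 1))))
    (z 1) ?_ ?_
  · grind
  · generalize x 0 = x0 at *
    generalize y 0 = y0 at *
    generalize z 0 = z0 at *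
    generalize x 1 = b at *
    generalize y 1 = c at *
    generalize z 1 = d at *
    intro i hi hi' Q hQ hswap hmove
    have q1 : Q i b := by grind
    have q2 : Q b i := by grind
    have q3 : Q c i := by grind
    have q4 : Q i c := by grind
    have q5 : Q y0 c := by grind
    by_cases hd : i = d
    · have q6 : Q z0 d := by grind
      have q7 : Q c b := by grind
      have q8 : Q b c := by grind
      grind
    · have q6 : Q d i := by grind
      have q7 : Q i d := by grind
      have q8 : Q z0 d := by grind
      grind

theorem bubbleSortGraph_exists_trees_of_card_eq_three {n : ℕ} {S : Finset (Fin 2 ↪ Fin n)}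
    (hS : S.card = 3) :
    ∃ T : Fin (n - 2) → (bubbleSortGraph n 2).Subgraph,
      (bubbleSortGraph n 2).IsInternallyDisjointTrees S T := by
  have main : ∀ x y z : Fin 2 ↪ Fin n, x 0 ≠ y 0 → x 1 = y 1 → x 1 ≠ z 1 →
      ∃ T : Fin (n - 2) → (bubbleSortGraph n 2).Subgraph,
        (bubbleSortGraph n 2).IsInternallyDisjointTrees {x, y, z} T := by
    intro x y z h0 h1 h2
    by_cases h3 : y 0 = z 1
    · rw [Finset.insert_comm]
      exact bubbleSortGraph_exists_trees_of_two_same_last h1.symm (h1 ▸ h2)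
        (fun h => h0 (h.trans h3.symm))
    · exact bubbleSortGraph_exists_trees_of_two_same_last h1 h2 h3
  have hne : ∀ u v : Fin 2 ↪ Fin n, u ≠ v → u 1 = v 1 → u 0 ≠ v 0 := fun u v h h1 h0 =>
    h (embedding_fin_two_ext h0 h1)
  obtain ⟨x, y, z, hxy, hxz, hyz, rfl⟩ := Finset.card_eq_three.1 hS
  by_cases h1 : x 1 = y 1
  · by_cases h2 : x 1 = z 1
    · exact bubbleSortGraph_exists_trees_of_same_last (hne _ _ hxy h1) (hne _ _ hxz h2)
        (hne _ _ hyz (h1.symm.trans h2)) h1 h2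
    · exact main x y z (hne _ _ hxy h1) h1 h2
  · by_cases h2 : x 1 = z 1
    · rw [Finset.pair_comm y z]
      exact main x z y (hne _ _ hxz h2) h2 h1
    · by_cases h3 : y 1 = z 1
      · rw [Finset.insert_comm, Finset.pair_comm x z]
        exact main y z x (hne _ _ hyz h3) h3 (Ne.symm h1)
      · exact bubbleSortGraph_exists_trees_of_distinct_last h1 h2 h3

/-! ### Upper bound and conclusion -/

theorem bubbleSortGraph_le_of_neighbor_ne {n r : ℕ} {S : Finset (Fin 2 ↪ Fin n)}
    {T : Fin r → (bubbleSortGraph n 2).Subgraph}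
    (hT : (bubbleSortGraph n 2).IsInternallyDisjointTrees S T) {u v : Fin 2 ↪ Fin n}
    (h0 : u 0 = v 1) (h1 : u 1 = v 0) (h : ∀ i, ∃ x, x ≠ v ∧ (T i).Adj u x) : r ≤ n - 2 := by
  choose x hxv hx using h
  -- As `v` is the swap of `u`, the other neighbours of `u` share its last symbol; their first
  -- symbol avoids both symbols of `u`, and edge-disjointness makes it differ from tree to tree.
  have hadj : ∀ i, x i 0 ≠ u 0 ∧ x i 1 = u 1 := by
    intro i
    rcases bubbleSortGraph_two_adj.1 ((T i).adj_sub (hx i)) with ⟨h2, h3⟩ | ⟨h2, h3⟩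
    · exact absurd (embedding_fin_two_ext (h3.symm.trans h1) (h2.symm.trans h0)) (hxv i)
    · exact ⟨h2.symm, h3.symm⟩
  have hinj : Function.Injective fun i => x i 0 := by
    intro i j hij
    by_contra hne
    have hxx : x i = x j := embedding_fin_two_ext hij ((hadj i).2.trans (hadj j).2.symm)
    refine Set.disjoint_left.1 (hT.disjoint_edges i j hne)
      (show s(u, x i) ∈ (T i).edgeSet from hx i) ?_
    rw [hxx]
    exact hx j
  rw [← card_compl_pair (embedding_fin_two_ne u), ← Fintype.card_fin r, ← Finset.card_univ]
  refine Finset.card_le_card_of_injOn (fun i => x i 0) (fun i _ => ?_) hinj.injOn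
  have := embedding_fin_two_ne (x i)
  rw [(hadj i).2] at this
  simp [(hadj i).1, this]

theorem theorem1 (n : ℕ) (hn : 3 ≤ n) :
    SimpleGraph.generalizedConnectivity 3 (bubbleSortGraph n 2) = ((n - 2 : ℕ) : ℕ∞) := by
  apply le_antisymm
  · let a : Fin n := ⟨0, by omega⟩
    let b : Fin n := ⟨1, by omega⟩
    let c : Fin n := ⟨2, by omega⟩
    have hab : a ≠ b := by simp [a, b]
    have hca : c ≠ a := by simp [a, c]
    have hcb : c ≠ b := by simp [b, c]
    let u := arrangement a b hab
    let v := arrangement b a hab.symm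
    let w := arrangement c b hcb
    have huv : u ≠ v := fun h => hab (DFunLike.congr_fun h 0)
    have huw : u ≠ w := fun h => hca (DFunLike.congr_fun h 0).symm
    have hvw : v ≠ w := fun h => hab (DFunLike.congr_fun h 1)
    have hle : generalizedConnectivity 3 (bubbleSortGraph n 2) ≤
        (bubbleSortGraph n 2).treeConnectivity {u, v, w} :=
      sInf_le ⟨_, Finset.card_eq_three.2 ⟨u, v, w, huv, huw, hvw, rfl⟩, rfl⟩
    refine hle.trans (sSup_le ?_)
    rintro _ ⟨r, T, hT, rfl⟩
    rw [Nat.cast_le]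
    rcases hT.exists_neighbor_ne (u := u) (v := v) (w := w) (by simp) (by simp) (by simp)
      huv huw hvw with h | h
    · exact bubbleSortGraph_le_of_neighbor_ne hT rfl rfl h
    · exact bubbleSortGraph_le_of_neighbor_ne hT rfl rfl h
  · refine le_sInf ?_
    rintro _ ⟨S, hS, rfl⟩
    obtain ⟨T, hT⟩ := bubbleSortGraph_exists_trees_of_card_eq_three hS
    exact le_sSup ⟨_, T, hT, rfl⟩
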